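/- Let $d\ge 1$ be an integer, $s\in\mathbb{R}$ and $1<p<\infty$. Let $\lambda=\bigotimes_{\ell=1}^\infty\rho_\ell$ be the $B^s_p$ prior on $\mathbb{R}^\infty$ with its Borel $\sigma$-algebra, where $\rho_\ell$ is the law of $\ell^{-\frac sd-\frac12+\frac1p}X_\ell$ and $X_\ell$ has the probability density $\pi_X(x)=\sigma_p e^{-|x|^p}$ on $\mathbb{R}$, $\sigma_p=\big(\int_{\mathbb{R}}e^{-|x|^p}\,dx\big)^{-1}$; that is, $\lambda$ is the law of the coefficient sequence of the random wavelet series $\sum_\ell \ell^{-\frac sd-\frac12+\frac1p}X_\ell\psi_\ell$ on the torus $\mathbb{T}^d$ with i.i.d. $X_\ell\sim\pi_X$. Identify a wavelet series $\sum_{\ell} c_\ell\psi_\ell$ with its coefficient sequence $(c_\ell)_{\ell\ge1}\in\mathbb{R}^\infty$, so that for $\sigma\in\mathbb{R}$ and $q\ge1$ $$B^{\sigma}_q(\mathbb{T}^d)=\Big\{c\in\mathbb{R}^\infty : \sum_{\ell=1}^\infty \ell^{\,q(\frac{\sigma}{d}+\frac12)-1}|c_\ell|^q<\infty\Big\}.$$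 A finite measure $\mu$ is Fomin differentiable along a vector $h$ if for every Borel set $A$ the finite limit $d_h\mu(A)=\lim_{t\to0}\frac{\mu(A+th)-\mu(A)}{t}$ exists; $D(\mu)$ denotes the set of all such $h$, and the logarithmic derivative $\beta^\mu_h\in L^1(\mu)$ is the density of $d_h\mu$ with respect to $\mu$, i.e. $d_h\mu(A)=\int_A\beta^\mu_h\,d\mu$ for all Borel sets $A$. Theorem. The set of differentiability of $\lambda$ is $$D(\lambda)=B^{\,s+(\frac12-\frac1p)d}_2(\mathbb{T}^d)=\Big\{h\in\mathbb{R}^\infty : \sum_{\ell=1}^\infty \ell^{\frac{2s}{d}+1-\frac2p}h_\ell^2<\infty\Big\}.$$ For every $\ell\ge1$ and $a\in\mathbb{R}$, the logarithmic derivative of $\rho_\ell$ along $a$ is $$\beta^{\rho_\ell}_{a}(x)=a\Big(-p\,\mathrm{sign}(x)\,\ell^{\,p(\frac sd+\frac12)-1}|x|^{p-1}\Big).$$ For every $h\in D(\lambda)$ the logarithmic derivative $\beta^\lambda_h$ exists and $$\beta^\lambda_h(u)=\lim_{N\to\infty}\sum_{\ell=1}^N\beta^{\rho_\ell}_{h_\ell}(u_\ell)\quad\text{in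 }L^1(\lambda).$$ -/

import Mathlib

open MeasureTheory Filter Topology

section FominCalculus

variable {X : Type*} [AddCommGroup X] [Module ℝ X] [MeasurableSpace X]

/-- The limit defining the Fomin derivative of `μ` along `h` at the set `A` exists, is finite and
equals `L`: `(μ(A + t h) - μ(A)) / t → L` as `t → 0`, `t ≠ 0`. -/
def HasFominDerivAt (μ : Measure X) (h : X) (A : Set X) (L : ℝ) : Prop :=
  Tendsto (fun t : ℝ => (μ.real ((fun x => x + t • h) '' A) - μ.real A) / t) (𝓝[≠] 0) (𝓝 L)

/-- `μ` is Fomin differentiable along `h`: for every measurable `A` the limit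
`d_h μ(A) = lim_{t → 0} (μ(A + t h) - μ(A)) / t` exists and is finite. -/
def IsFominDifferentiable (μ : Measure X) (h : X) : Prop :=
  ∀ A : Set X, MeasurableSet A → ∃ L : ℝ, HasFominDerivAt μ h A L

/-- The domain of differentiability `D(μ)`. -/
def fominDomain (μ : Measure X) : Set X :=
  {h : X | IsFominDifferentiable μ h}

/-- `β` is (a version of) the logarithmic derivative of `μ` along `h`: it is `μ`-integrable and is
a density of `d_h μ` with respect to `μ`, that is, `d_h μ(A) = ∫_A β dμ` for all measurable `A`. -/
def IsLogDerivative (μ : Measure X) (h : X) (β : X → ℝ) : Prop :=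
  Integrable β μ ∧ ∀ A : Set X, MeasurableSet A → HasFominDerivAt μ h A (∫ x in A, β x ∂μ)

end FominCalculus

/-!
Coordinates are indexed by `n : ℕ`; the index `n` stands for the wavelet index `ℓ = n + 1 ≥ 1`.
A wavelet series `∑ c_ℓ ψ_ℓ` on the torus `𝕋^d` is identified with its coefficient sequence.
-/

/-- The Besov space `B^s_p(𝕋^d) = B^s_{p,p}(𝕋^d)`, as the space of wavelet coefficient sequences
with finite norm `(∑_{ℓ ≥ 1} ℓ ^ (p (s / d + 1 / 2) - 1) |c_ℓ| ^ p) ^ (1 / p)`. -/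
def besovSpace (d : ℕ) (s p : ℝ) : Set (ℕ → ℝ) :=
  {c : ℕ → ℝ | Summable fun n : ℕ => ((n : ℝ) + 1) ^ (p * (s / d + 1 / 2) - 1) * |c n| ^ p}

/-- The probability density `π_X(x) = σ_p exp(-|x| ^ p)`, `σ_p = (∫ exp(-|x| ^ p) dx)⁻¹`. -/
noncomputable def besovDensity (p x : ℝ) : ℝ :=
  (∫ y : ℝ, Real.exp (-|y| ^ p))⁻¹ * Real.exp (-|x| ^ p)

/-- The law on `ℝ` with density `π_X`. -/
noncomputable def besovBaseLaw (p : ℝ) : Measure ℝ :=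
  volume.withDensity fun x => ENNReal.ofReal (besovDensity p x)

/-- `ρ_ℓ`, `ℓ = n + 1`: the law of `ℓ ^ (-s / d - 1 / 2 + 1 / p) X_ℓ`, where `X_ℓ` has density
`π_X`. -/
noncomputable def besovCoordLaw (d : ℕ) (s p : ℝ) (n : ℕ) : Measure ℝ :=
  (besovBaseLaw p).map fun x => ((n : ℝ) + 1) ^ (-s / d - 1 / 2 + 1 / p) * x

/-- The `B^s_p` prior `λ = ⨂_ℓ ρ_ℓ` on `ℝ^∞`, the law of the wavelet coefficients of
`U = ∑ ℓ ^ (-s / d - 1 / 2 + 1 / p) X_ℓ ψ_ℓ` with i.i.d. `X_ℓ` of density `π_X`. -/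
noncomputable def besovPrior (d : ℕ) (s p : ℝ) : Measure (ℕ → ℝ) :=
  Measure.infinitePi (besovCoordLaw d s p)

/-- The function `x ↦ a (-p sign(x) ℓ ^ (p (s / d + 1 / 2) - 1) |x| ^ (p - 1))`, `ℓ = n + 1`. -/
noncomputable def besovCoordLogDeriv (d : ℕ) (s p : ℝ) (n : ℕ) (a x : ℝ) : ℝ :=
  a * (-p * Real.sign x * ((n : ℝ) + 1) ^ (p * (s / d + 1 / 2) - 1) * |x| ^ (p - 1))

/-- For `p > 0` the density `π_X` does define a probability measure. -/
theorem isProbabilityMeasure_besovBaseLaw {p : ℝ} (hp : 0 < p) :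
    IsProbabilityMeasure (besovBaseLaw p) := by
  have hval : ∫ y : ℝ, Real.exp (-|y| ^ p) = 2 * Real.Gamma (1 / p + 1) := by
    rw [integral_comp_abs (f := fun y => Real.exp (-y ^ p)), integral_exp_neg_rpow hp]
  have hpos : 0 < ∫ y : ℝ, Real.exp (-|y| ^ p) := by
    rw [hval]
    have := Real.Gamma_pos_of_pos (s := 1 / p + 1) (by positivity)
    linarith
  have hint : Integrable fun y : ℝ => Real.exp (-|y| ^ p) := by
    by_contra hn
    rw [integral_undef hn] at hpos
    exact lt_irrefl _ hpos
  constructor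
  rw [besovBaseLaw, withDensity_apply _ MeasurableSet.univ, Measure.restrict_univ,
    ← ofReal_integral_eq_lintegral_ofReal]
  · simp only [besovDensity]
    rw [integral_const_mul, inv_mul_cancel₀ hpos.ne', ENNReal.ofReal_one]
  · exact hint.const_mul _
  · exact ae_of_all _ fun x => mul_nonneg (inv_nonneg.2 hpos.le) (Real.exp_pos _).le

/-- The coordinate laws are probability measures, so that `besovPrior` is their product. -/
theorem isProbabilityMeasure_besovCoordLaw (d : ℕ) (s : ℝ) {p : ℝ} (hp : 0 < p) (n : ℕ) :
    IsProbabilityMeasure (besovCoordLaw d s p n) := by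
  have := isProbabilityMeasure_besovBaseLaw hp
  exact Measure.isProbabilityMeasure_map (by fun_prop)

/-! Write c_ℓ for the scale of ρ_ℓ. The claim on D(λ) is that λ is differentiable along h exactly
when ∑ (h_ℓ / c_ℓ)² < ∞, which is the stated Besov condition (`mem_besovSpace_iff`).

Sufficiency. The coordinate scores are independent and centred, with second moment proportional to
(h_ℓ / c_ℓ)², so their series is orthogonal and converges in L²(λ), hence in L¹(λ)
(`exists_integrable_tendsto_eLpNorm_sum`). The product rule shows that the limit B has the right
integrals on finite-dimensional cylinders. To reach all Borel sets, the derivative is replaced by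
the identity μ(A + th) - μ(A) = ∫₀ᵗ ∫_{A+uh} B dμ du, which survives a π-λ argument
(`measureReal_fominTranslate_sub_eq_integral`). It yields a Lipschitz bound uniform in A, hence
continuity of u ↦ ∫_{A+uh} B dμ, and the fundamental theorem of calculus recovers the derivative
(`isLogDerivative_of_isPiSystem`).

Necessity. If the sum diverges, λ and each of its translates by th, t ≠ 0, are told apart by a
weighted sum of signs of finitely many coordinates: its mean shift grows like V while its variance
is at most V, with V unbounded (`exists_measurableSet_besovPrior_separating`). Intersecting such
sets for t = 1/(k+1) gives one Borel set A for which t ↦ λ(A + th) is discontinuous at 0, so no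
derivative exists there. -/

theorem norm_setIntegral_le_integral_norm {X : Type*} [MeasurableSpace X] {μ : Measure X} {β : X → ℝ}
    (hβ : Integrable β μ) (A : Set X) :
    ‖∫ x in A, β x ∂μ‖ ≤ ∫ x, ‖β x‖ ∂μ :=
  (norm_integral_le_integral_norm _).trans
    (setIntegral_le_integral hβ.norm (ae_of_all _ fun _ => norm_nonneg _))

/-! ### Translates of sets and Fomin derivatives of a finite measure -/

section FominTranslate

variable {X : Type*} [AddCommGroup X] [Module ℝ X]

/-- The translate `A + t h`, written as a preimage. -/
def fominTranslate (h : X) (t : ℝ) (A : Set X) : Set X := (fun x => x - t • h) ⁻¹' A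

theorem image_add_smul_eq_fominTranslate (h : X) (t : ℝ) (A : Set X) :
    (fun x => x + t • h) '' A = fominTranslate h t A := by
  rw [Set.image_add_right, fominTranslate]
  simp only [sub_eq_add_neg]

theorem mem_fominTranslate {h : X} {t : ℝ} {A : Set X} {x : X} :
    x ∈ fominTranslate h t A ↔ x - t • h ∈ A := Iff.rfl

theorem fominTranslate_zero (h : X) (A : Set X) : fominTranslate h 0 A = A := by
  ext x; simp [mem_fominTranslate]

theorem fominTranslate_fominTranslate (h : X) (t u : ℝ) (A : Set X) :
    fominTranslate h t (fominTranslate h u A) = fominTranslate h (u + t) A := by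
  ext x
  simp only [mem_fominTranslate, add_smul, sub_sub, add_comm]

theorem fominTranslate_compl (h : X) (t : ℝ) (A : Set X) :
    fominTranslate h t Aᶜ = (fominTranslate h t A)ᶜ := rfl

theorem fominTranslate_diff (h : X) (t : ℝ) (A B : Set X) :
    fominTranslate h t (A \ B) = fominTranslate h t A \ fominTranslate h t B := rfl

theorem fominTranslate_iUnion (h : X) (t : ℝ) (A : ℕ → Set X) :
    fominTranslate h t (⋃ n, A n) = ⋃ n, fominTranslate h t (A n) := Set.preimage_iUnion

variable [MeasurableSpace X] {μ : Measure X} {h : X} {β : X → ℝ}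

theorem hasFominDerivAt_iff {A : Set X} {L : ℝ} :
    HasFominDerivAt μ h A L ↔ HasDerivAt (fun t => μ.real (fominTranslate h t A)) L 0 := by
  rw [HasFominDerivAt, hasDerivAt_iff_tendsto_slope_zero]
  simp only [image_add_smul_eq_fominTranslate, fominTranslate_zero, zero_add, smul_eq_mul,
    div_eq_inv_mul]

/-- The translates form a one-parameter group, so differentiability at time 0 for all measurable
sets gives it at every time. -/
theorem hasFominDerivAt_fominTranslate_iff {A : Set X} {L : ℝ} (t : ℝ) :
    HasFominDerivAt μ h (fominTranslate h t A) L ↔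
      HasDerivAt (fun t => μ.real (fominTranslate h t A)) L t := by
  rw [hasFominDerivAt_iff]
  simp only [fominTranslate_fominTranslate]
  constructor
  · intro H
    have := HasDerivAt.comp_sub_const t t (f := fun u => μ.real (fominTranslate h (t + u) A))
      (by simpa using H)
    simpa using this
  · intro H
    exact HasDerivAt.comp_const_add (f := fun u => μ.real (fominTranslate h u A)) t 0
      (by simpa using H)

variable [TopologicalSpace X] [IsTopologicalAddGroup X] [BorelSpace X]

theorem MeasurableSet.fominTranslate {A : Set X} (hA : MeasurableSet A) (h : X) (t : ℝ) :
    MeasurableSet (fominTranslate h t A) := by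
  have : Continuous fun x : X => x - t • h := by fun_prop
  exact this.measurable hA

variable [ContinuousSMul ℝ X]

theorem IsLogDerivative.hasDerivAt (H : IsLogDerivative μ h β) {A : Set X} (hA : MeasurableSet A)
    (t : ℝ) : HasDerivAt (fun t => μ.real (_root_.fominTranslate h t A))
      (∫ x in _root_.fominTranslate h t A, β x ∂μ) t :=
  (hasFominDerivAt_fominTranslate_iff t).1 (H.2 _ (hA.fominTranslate h t))

theorem IsLogDerivative.abs_sub_le (H : IsLogDerivative μ h β) {A : Set X} (hA : MeasurableSet A)
    (t : ℝ) : |μ.real (_root_.fominTranslate h t A) - μ.real A| ≤ (∫ x, ‖β x‖ ∂μ) * |t| := by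
  have := (convex_univ (𝕜 := ℝ) (E := ℝ)).norm_image_sub_le_of_norm_hasDerivWithin_le
    (fun u _ => (H.hasDerivAt hA u).hasDerivWithinAt)
    (fun u _ => norm_setIntegral_le_integral_norm H.1 _) (Set.mem_univ 0) (Set.mem_univ t)
  simpa [fominTranslate_zero] using this

theorem IsLogDerivative.integral_eq_zero (H : IsLogDerivative μ h β) : ∫ x, β x ∂μ = 0 := by
  have := H.hasDerivAt MeasurableSet.univ 0
  simp only [_root_.fominTranslate, Set.preimage_univ, Measure.restrict_univ] at this
  exact this.unique (hasDerivAt_const _ _)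

variable [IsFiniteMeasure μ]

/-- A point of an open U lies in U + th for all small t, so U \ (U + th) shrinks pointwise to the
empty set. The other half of the symmetric difference exceeds it in measure by μ(U + th) - μ(U) ≤
C|t|. -/
theorem tendsto_measureReal_symmDiff_fominTranslate_of_isOpen {C : ℝ}
    (hC : ∀ A, MeasurableSet A → ∀ t, |μ.real (fominTranslate h t A) - μ.real A| ≤ C * |t|)
    {U : Set X} (hU : IsOpen U) :
    Tendsto (fun t => μ.real (symmDiff (fominTranslate h t U) U)) (𝓝 0) (𝓝 0) := by
  have hUm := hU.measurableSet
  have h1 : Tendsto (fun t => μ.real (U \ fominTranslate h t U)) (𝓝 0) (𝓝 0) := by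
    have := tendsto_measure_of_tendsto_indicator_of_isFiniteMeasure (𝓝 (0 : ℝ)) (A := ∅)
      (As := fun t => U \ fominTranslate h t U) μ (fun t => hUm.diff (hUm.fominTranslate h t)) ?_
    · simpa [Measure.real, Function.comp_def] using (ENNReal.tendsto_toReal (by simp)).comp this
    · intro x
      by_cases hx : x ∈ U
      · have hc : Tendsto (fun t : ℝ => x - t • h) (𝓝 0) (𝓝 x) := by
          have : Continuous fun t : ℝ => x - t • h := by fun_prop
          simpa using this.tendsto 0
        filter_upwards [hc.eventually (hU.mem_nhds hx)] with t ht
        have ht' : x - t • h ∈ U := ht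
        simp [mem_fominTranslate, ht']
      · exact Eventually.of_forall fun t => by simp [hx]
  have h2 : Tendsto (fun t => 2 * μ.real (U \ fominTranslate h t U) + C * |t|) (𝓝 0) (𝓝 0) := by
    have h3 : Tendsto (fun t : ℝ => C * |t|) (𝓝 0) (𝓝 0) := by
      have : Continuous fun t : ℝ => C * |t| := by fun_prop
      simpa using this.tendsto 0
    simpa using (h1.const_mul 2).add h3
  refine squeeze_zero (fun t => measureReal_nonneg) (fun t => ?_) h2
  have hT := hUm.fominTranslate h t
  rw [measureReal_symmDiff_eq hT hUm]
  have e1 := measureReal_sdiff_add_inter (μ := μ) (s := fominTranslate h t U) hUm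
  have e2 := measureReal_sdiff_add_inter (μ := μ) (s := U) hT
  rw [Set.inter_comm] at e2
  have := (abs_le.1 (hC U hUm t)).2
  linarith

section

variable [SecondCountableTopology X]

/-- Allows integration in t before continuity in t is available for general A. -/
theorem aestronglyMeasurable_setIntegral_fominTranslate (hβ : Integrable β μ)
    {A : Set X} (hA : MeasurableSet A) :
    AEStronglyMeasurable (fun t => ∫ x in fominTranslate h t A, β x ∂μ) volume := by
  have hc : Continuous fun z : ℝ × X => z.2 - z.1 • h := by fun_prop
  have hS : MeasurableSet {z : ℝ × X | z.2 - z.1 • h ∈ A} := hc.measurable hA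
  have h1 : AEStronglyMeasurable (fun z : ℝ × X => β z.2) ((volume : Measure ℝ).prod μ) :=
    hβ.aestronglyMeasurable.comp_snd
  have h2 := (h1.indicator hS).integral_prod_right'
  refine h2.congr (ae_of_all _ fun t => ?_)
  simp only
  rw [← integral_indicator (hA.fominTranslate h t)]
  rfl

/-- A derivative at a point need not pass to countable disjoint unions, but this integrated form
does: both sides are countably additive in A, with ∫ ‖β‖ as a dominating bound. Complements use ∫ β
= 0. -/
theorem measureReal_fominTranslate_sub_eq_integral {S : Set (Set X)}
    (hgen : ‹MeasurableSpace X› = MeasurableSpace.generateFrom S) (hS : IsPiSystem S)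
    (hβ : Integrable β μ) (h0 : ∫ x, β x ∂μ = 0)
    (hderiv : ∀ A ∈ S, ∀ t, HasDerivAt (fun t => μ.real (fominTranslate h t A))
      (∫ x in fominTranslate h t A, β x ∂μ) t)
    (hcont : ∀ A ∈ S, Continuous fun t => ∫ x in fominTranslate h t A, β x ∂μ)
    {A : Set X} (hA : MeasurableSet A) (t : ℝ) :
    μ.real (fominTranslate h t A) - μ.real A =
      ∫ u in 0..t, ∫ x in fominTranslate h u A, β x ∂μ := by
  induction A, hA using MeasurableSpace.induction_on_inter hgen hS with
  | empty => simp [fominTranslate]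
  | basic A hA =>
    rw [intervalIntegral.integral_eq_sub_of_hasDerivAt (fun u _ => hderiv A hA u)
      ((hcont A hA).intervalIntegrable _ _), fominTranslate_zero]
  | compl A hA ih =>
    have hT := fun u => hA.fominTranslate h u
    have e : ∀ u, ∫ x in fominTranslate h u Aᶜ, β x ∂μ
        = -∫ x in fominTranslate h u A, β x ∂μ := by
      intro u
      have := integral_add_compl (hT u) hβ
      rw [fominTranslate_compl]
      linarith
    simp only [e, intervalIntegral.integral_neg, ← ih]
    rw [fominTranslate_compl, measureReal_compl (hT t), measureReal_compl hA]
    ring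
  | iUnion f hd hf ih =>
    have hT := fun n u => (hf n).fominTranslate h u
    have hdT : ∀ u, Pairwise (Function.onFun Disjoint fun n => fominTranslate h u (f n)) :=
      fun u i j hij => (hd hij).preimage _
    have hmeas : ∀ u, HasSum (fun n => μ.real (fominTranslate h u (f n)))
        (μ.real (fominTranslate h u (⋃ n, f n))) := by
      intro u
      rw [fominTranslate_iUnion]
      have := hasSum_integral_iUnion (f := fun _ => (1 : ℝ)) (μ := μ) (fun n => hT n u) (hdT u)
        (integrable_const _).integrableOn
      simpa using this
    have hint : ∀ u (g : X → ℝ), Integrable g μ →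
        HasSum (fun n => ∫ x in fominTranslate h u (f n), g x ∂μ)
          (∫ x in fominTranslate h u (⋃ n, f n), g x ∂μ) := by
      intro u g hg
      rw [fominTranslate_iUnion]
      exact hasSum_integral_iUnion (fun n => hT n u) (hdT u) hg.integrableOn
    have hL : HasSum (fun n => μ.real (fominTranslate h t (f n)) - μ.real (f n))
        (μ.real (fominTranslate h t (⋃ n, f n)) - μ.real (⋃ n, f n)) := by
      simpa only [fominTranslate_zero] using (hmeas t).sub (hmeas 0)
    refine hL.unique ?_
    simp only [ih]
    refine intervalIntegral.hasSum_integral_of_dominated_convergence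
      (fun n u => ∫ x in fominTranslate h u (f n), ‖β x‖ ∂μ)
      (fun n => (aestronglyMeasurable_setIntegral_fominTranslate hβ (hf n)).restrict)
      (fun n => ae_of_all _ fun u _ => norm_integral_le_integral_norm _)
      (ae_of_all _ fun u _ => (hint u _ hβ.norm).summable) ?_
      (ae_of_all _ fun u _ => hint u _ hβ)
    simp only [fun u => (hint u _ hβ.norm).tsum_eq]
    refine (intervalIntegrable_const (c := ∫ x, ‖β x‖ ∂μ)).mono_fun
      (aestronglyMeasurable_setIntegral_fominTranslate hβ.norm (.iUnion hf)).restrict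
      (ae_of_all _ fun u => ?_)
    simpa using (norm_setIntegral_le_integral_norm hβ.norm _).trans (le_abs_self _)

end

variable [TopologicalSpace.PseudoMetrizableSpace X]

/-- Outer regularity reduces to an open U ⊇ A. The translated error (U \ A) + th has measure at most
μ(U \ A) + C|t|, because the Lipschitz bound is uniform over sets. -/
theorem tendsto_measureReal_symmDiff_fominTranslate {C : ℝ}
    (hC : ∀ A, MeasurableSet A → ∀ t, |μ.real (fominTranslate h t A) - μ.real A| ≤ C * |t|)
    {A : Set X} (hA : MeasurableSet A) :
    Tendsto (fun t => μ.real (symmDiff (fominTranslate h t A) A)) (𝓝 0) (𝓝 0) := by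
  rw [Metric.tendsto_nhds]
  intro ε hε
  obtain ⟨U, hAU, hU, -, hlt⟩ := hA.exists_isOpen_sdiff_lt (μ := μ) (measure_ne_top μ A)
    (ε := ENNReal.ofReal (ε / 4)) (by positivity)
  have hlt' : μ.real (U \ A) < ε / 4 := by
    rw [Measure.real, ← ENNReal.lt_ofReal_iff_toReal_lt (measure_ne_top _ _)]
    exact hlt
  have hUm := hU.measurableSet
  have h2 : Tendsto (fun t => μ.real (symmDiff (fominTranslate h t U) U) + C * |t|)
      (𝓝 0) (𝓝 0) := by
    have h3 : Tendsto (fun t : ℝ => C * |t|) (𝓝 0) (𝓝 0) := by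
      have : Continuous fun t : ℝ => C * |t| := by fun_prop
      simpa using this.tendsto 0
    simpa using (tendsto_measureReal_symmDiff_fominTranslate_of_isOpen hC hU).add h3
  filter_upwards [h2.eventually (gt_mem_nhds (show 0 < ε / 2 by positivity))] with t ht
  rw [Real.dist_eq, sub_zero, abs_of_nonneg measureReal_nonneg]
  have i1 := measureReal_symmDiff_le (μ := μ) (s := fominTranslate h t A)
    (t := fominTranslate h t U) A
  have i2 := measureReal_symmDiff_le (μ := μ) (s := fominTranslate h t U) (t := U) A
  have e1 : symmDiff (fominTranslate h t A) (fominTranslate h t U)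
      = fominTranslate h t (U \ A) := by
    rw [symmDiff_of_le (show fominTranslate h t A ≤ fominTranslate h t U from
      Set.preimage_mono hAU), fominTranslate_diff]
  have e2 : symmDiff U A = U \ A := symmDiff_of_ge hAU
  rw [e1] at i1
  rw [e2] at i2
  have := (abs_le.1 (hC _ (hUm.diff hA) t)).2
  linarith

theorem continuous_setIntegral_fominTranslate {C : ℝ}
    (hC : ∀ A, MeasurableSet A → ∀ t, |μ.real (fominTranslate h t A) - μ.real A| ≤ C * |t|)
    (hβ : Integrable β μ) {A : Set X} (hA : MeasurableSet A) :
    Continuous fun t => ∫ x in fominTranslate h t A, β x ∂μ := by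
  have key : ∀ B, MeasurableSet B →
      Tendsto (fun t => ∫ x in fominTranslate h t B, β x ∂μ) (𝓝 0) (𝓝 (∫ x in B, β x ∂μ)) := by
    intro B hB
    have h0 := tendsto_measureReal_symmDiff_fominTranslate hC hB
    have h1 : Tendsto (fun t => ∫ x in symmDiff (fominTranslate h t B) B, ‖β x‖ ∂μ)
        (𝓝 0) (𝓝 0) := by
      refine hβ.norm.tendsto_setIntegral_nhds_zero ?_
      have := ENNReal.tendsto_ofReal h0
      simpa [Function.comp_def, Measure.real, ENNReal.ofReal_toReal] using this
    rw [tendsto_iff_norm_sub_tendsto_zero]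
    refine squeeze_zero (fun _ => norm_nonneg _) (fun t => ?_) h1
    have hT := hB.fominTranslate h t
    rw [← integral_indicator hT, ← integral_indicator hB,
      ← integral_sub (hβ.indicator hT) (hβ.indicator hB), ← integral_indicator (hT.symmDiff hB)]
    refine norm_integral_le_of_norm_le (hβ.norm.indicator (hT.symmDiff hB)) (ae_of_all _ ?_)
    intro x
    by_cases h1 : x ∈ fominTranslate h t B <;> by_cases h2 : x ∈ B <;>
      simp [h1, h2, Set.mem_symmDiff]
  rw [continuous_iff_continuousAt]
  intro t
  have := key _ (hA.fominTranslate h t)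
  simp only [fominTranslate_fominTranslate] at this
  have h2 : Tendsto (fun u : ℝ => u - t) (𝓝 t) (𝓝 0) := by
    have : Continuous fun u : ℝ => u - t := by fun_prop
    simpa using this.tendsto t
  simpa [ContinuousAt, Function.comp_def] using this.comp h2

theorem IsLogDerivative.continuous_setIntegral (H : IsLogDerivative μ h β) {A : Set X}
    (hA : MeasurableSet A) :
    Continuous fun t => ∫ x in _root_.fominTranslate h t A, β x ∂μ :=
  continuous_setIntegral_fominTranslate (fun _ hB => H.abs_sub_le hB) H.1 hA

variable [SecondCountableTopology X]

/-- A log-derivative may be checked on the translates of the sets of a generating π-system. -/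
theorem isLogDerivative_of_isPiSystem {S : Set (Set X)}
    (hgen : ‹MeasurableSpace X› = MeasurableSpace.generateFrom S) (hS : IsPiSystem S)
    (hβ : Integrable β μ) (h0 : ∫ x, β x ∂μ = 0)
    (hderiv : ∀ A ∈ S, ∀ t, HasDerivAt (fun t => μ.real (fominTranslate h t A))
      (∫ x in fominTranslate h t A, β x ∂μ) t)
    (hcont : ∀ A ∈ S, Continuous fun t => ∫ x in fominTranslate h t A, β x ∂μ) :
    IsLogDerivative μ h β := by
  have key := fun {A : Set X} (hA : MeasurableSet A) =>
    measureReal_fominTranslate_sub_eq_integral hgen hS hβ h0 hderiv hcont hA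
  have hC : ∀ A, MeasurableSet A → ∀ t,
      |μ.real (fominTranslate h t A) - μ.real A| ≤ (∫ x, ‖β x‖ ∂μ) * |t| := by
    intro A hA t
    rw [key hA t]
    simpa using intervalIntegral.norm_integral_le_of_norm_le_const (a := 0) (b := t)
      (fun u _ => norm_setIntegral_le_integral_norm hβ (fominTranslate h u A))
  refine ⟨hβ, fun A hA => hasFominDerivAt_iff.2 ?_⟩
  -- The integrand of the integrated identity is now continuous, so that identity can be
  -- differentiated at 0.
  have hc := continuous_setIntegral_fominTranslate hC hβ hA
  have := (hc.integral_hasStrictDerivAt 0 0).hasDerivAt.const_add (μ.real A)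
  simp only [← key hA, fominTranslate_zero] at this
  simpa using this

end FominTranslate

/-! ### Infinite products: cylinders and L² series of independent scores -/

section InfinitePi

variable {μ : ℕ → Measure ℝ} [∀ n, IsProbabilityMeasure (μ n)]

theorem integral_infinitePi_prod {φ : ℕ → ℝ → ℝ} (hφ : ∀ n, Measurable (φ n)) (s : Finset ℕ) :
    ∫ x, ∏ i ∈ s, φ i (x i) ∂Measure.infinitePi μ = ∏ i ∈ s, ∫ y, φ i y ∂μ i := by
  have h := integral_restrict_infinitePi (μ := μ) (s := s)
    (f := fun y : (i : s) → ℝ => ∏ i : s, φ i (y i))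
    (Measurable.aestronglyMeasurable (by fun_prop))
  rw [integral_fintype_prod_eq_prod (fun (i : s) y => φ i y),
    Finset.prod_coe_sort s (fun i => ∫ y, φ i y ∂μ i)] at h
  rw [← h]
  refine integral_congr_ae (ae_of_all _ fun x => ?_)
  exact (Finset.prod_coe_sort s (fun i => φ i (x i))).symm

theorem setIntegral_infinitePi_eval_of_mem {t : ℕ → Set ℝ} (ht : ∀ n, MeasurableSet (t n))
    {g : ℝ → ℝ} (hg : Measurable g) {s : Finset ℕ} {n : ℕ} (hn : n ∈ s) :
    ∫ x in (s : Set ℕ).pi t, g (x n) ∂Measure.infinitePi μ =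
      (∏ i ∈ s.erase n, (μ i).real (t i)) * ∫ y in t n, g y ∂μ n := by
  classical
  let φ : ℕ → ℝ → ℝ := fun i => (t i).indicator (if i = n then g else 1)
  have hφ : ∀ i, Measurable (φ i) := by
    intro i
    refine Measurable.indicator ?_ (ht i)
    split_ifs
    exacts [hg, measurable_one]
  have hpi : MeasurableSet ((s : Set ℕ).pi t) := .pi s.countable_toSet fun i _ => ht i
  rw [← integral_indicator hpi]
  have e : ∀ x : ℕ → ℝ, ((s : Set ℕ).pi t).indicator (fun x => g (x n)) x
      = ∏ i ∈ s, φ i (x i) := by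
    intro x
    by_cases hx : x ∈ (s : Set ℕ).pi t
    · rw [Set.indicator_of_mem hx, Finset.prod_eq_single_of_mem n hn]
      · simp [φ, Set.indicator_of_mem (hx n hn)]
      · intro i hi hin
        simp [φ, Set.indicator_of_mem (hx i hi), hin]
    · rw [Set.indicator_of_notMem hx]
      simp only [Set.mem_pi, not_forall] at hx
      obtain ⟨i, hi, hxi⟩ := hx
      exact (Finset.prod_eq_zero hi (Set.indicator_of_notMem hxi _)).symm
  simp only [e]
  rw [integral_infinitePi_prod hφ, ← Finset.prod_erase_mul _ _ hn]
  congr 1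
  · refine Finset.prod_congr rfl fun i hi => ?_
    simp [φ, Finset.ne_of_mem_erase hi, integral_indicator_one (ht i)]
  · simp [φ, integral_indicator (ht n)]

theorem setIntegral_infinitePi_eval_of_notMem {t : ℕ → Set ℝ} (ht : ∀ n, MeasurableSet (t n))
    {g : ℝ → ℝ} (hg : Measurable g) {s : Finset ℕ} {n : ℕ} (hn : n ∉ s) :
    ∫ x in (s : Set ℕ).pi t, g (x n) ∂Measure.infinitePi μ =
      (∏ i ∈ s, (μ i).real (t i)) * ∫ y, g y ∂μ n := by
  classical
  -- The same cylinder, with the n-th side constrained only to lie in ℝ, so that n joins the index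
  -- set.
  let t' := Function.update t n Set.univ
  have ht' : ∀ i, MeasurableSet (t' i) := by
    intro i
    by_cases hi : i = n
    · subst hi; simp [t']
    · simp [t', hi, ht i]
  have hne : ∀ i ∈ s, t' i = t i := fun i hi =>
    Function.update_of_ne (fun e : i = n => hn (e ▸ hi)) _ _
  have hs : (s : Set ℕ).pi t = ((insert n s : Finset ℕ) : Set ℕ).pi t' := by
    ext x
    simp only [Set.mem_pi, Finset.coe_insert, Set.mem_insert_iff, forall_eq_or_imp,
      Finset.mem_coe]
    constructor
    · exact fun H => ⟨by simp [t'], fun i hi => by rw [hne i hi]; exact H i hi⟩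
    · exact fun H i hi => by rw [← hne i hi]; exact H.2 i hi
  rw [hs, setIntegral_infinitePi_eval_of_mem ht' hg (Finset.mem_insert_self n s),
    Finset.erase_insert hn]
  congr 1
  · exact Finset.prod_congr rfl fun i hi => by rw [hne i hi]
  · simp [t']

theorem fominTranslate_pi (h : ℕ → ℝ) (τ : ℝ) (s : Set ℕ) (t : ℕ → Set ℝ) :
    fominTranslate h τ (s.pi t) = s.pi fun i => fominTranslate (h i) τ (t i) := rfl

theorem measureReal_infinitePi_pi {t : ℕ → Set ℝ} (ht : ∀ n, MeasurableSet (t n))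
    (s : Finset ℕ) :
    (Measure.infinitePi μ).real ((s : Set ℕ).pi t) = ∏ i ∈ s, (μ i).real (t i) := by
  rw [Measure.real, Measure.infinitePi_pi _ fun i _ => ht i, ENNReal.toReal_prod]
  rfl

variable {h : ℕ → ℝ} {β : ℕ → ℝ → ℝ}

/-- Scores of coordinates outside s factor off and integrate to zero, so the value does not depend
on N. The right side is the form the product rule gives. -/
theorem setIntegral_infinitePi_sum_range (hβ : ∀ n, IsLogDerivative (μ n) (h n) (β n))
    (hm : ∀ n, Measurable (β n)) {t : ℕ → Set ℝ} (ht : ∀ n, MeasurableSet (t n)) {s : Finset ℕ}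
    {N : ℕ} (hN : s ⊆ Finset.range N) :
    ∫ x in (s : Set ℕ).pi t, ∑ n ∈ Finset.range N, β n (x n) ∂Measure.infinitePi μ =
      ∑ n ∈ s, (∏ i ∈ s.erase n, (μ i).real (t i)) * ∫ y in t n, β n y ∂μ n := by
  have hint : ∀ n, Integrable (fun x : ℕ → ℝ => β n (x n)) (Measure.infinitePi μ) := fun n =>
    (measurePreserving_eval_infinitePi μ n).integrable_comp_of_integrable (hβ n).1
  rw [integral_finsetSum _ fun n _ => (hint n).integrableOn, ← Finset.sum_subset hN]
  · exact Finset.sum_congr rfl fun n hn => setIntegral_infinitePi_eval_of_mem ht (hm n) hn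
  · intro n _ hn
    rw [setIntegral_infinitePi_eval_of_notMem ht (hm n) hn, (hβ n).integral_eq_zero, mul_zero]

/-- If the partial sums of the logarithmic derivatives of the factors converge in `L¹`, then the
limit is the logarithmic derivative of the product measure. -/
theorem isLogDerivative_infinitePi_of_tendsto (hβ : ∀ n, IsLogDerivative (μ n) (h n) (β n))
    (hm : ∀ n, Measurable (β n)) {B : (ℕ → ℝ) → ℝ} (hB : Integrable B (Measure.infinitePi μ))
    (hlim : Tendsto (fun N : ℕ => eLpNorm
      (fun x : ℕ → ℝ => (∑ n ∈ Finset.range N, β n (x n)) - B x) 1 (Measure.infinitePi μ))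
      atTop (𝓝 0)) :
    IsLogDerivative (Measure.infinitePi μ) h B := by
  have hint : ∀ n, Integrable (fun x : ℕ → ℝ => β n (x n)) (Measure.infinitePi μ) := fun n =>
    (measurePreserving_eval_infinitePi μ n).integrable_comp_of_integrable (hβ n).1
  have hpi : ∀ (s : Finset ℕ) (t : ℕ → Set ℝ), (∀ n, MeasurableSet (t n)) →
      ∫ x in (s : Set ℕ).pi t, B x ∂Measure.infinitePi μ =
        ∑ n ∈ s, (∏ i ∈ s.erase n, (μ i).real (t i)) * ∫ y in t n, β n y ∂μ n := by
    intro s t ht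
    have h1 := tendsto_setIntegral_of_L1' B hB.aestronglyMeasurable
      (F := fun (N : ℕ) (x : ℕ → ℝ) => ∑ n ∈ Finset.range N, β n (x n)) (l := atTop)
      (Eventually.of_forall fun N => integrable_finsetSum _ fun n _ => hint n) hlim
      ((s : Set ℕ).pi t)
    -- The approximating integrals are constant as soon as `range N` contains s.
    refine tendsto_nhds_unique h1 (tendsto_const_nhds.congr' ?_)
    obtain ⟨M, hM⟩ := s.exists_nat_subset_range
    filter_upwards [eventually_ge_atTop M] with N hN
    exact (setIntegral_infinitePi_sum_range hβ hm ht
      (hM.trans (Finset.range_mono hN))).symm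
  refine isLogDerivative_of_isPiSystem generateFrom_squareCylinders.symm
    (isPiSystem_squareCylinders (fun _ => MeasurableSpace.isPiSystem_measurableSet)
      fun _ => by simp) hB ?_ ?_ ?_
  · simpa using hpi ∅ (fun _ => Set.univ) fun _ => .univ
  · rintro _ ⟨s, t, ht, rfl⟩ τ
    have ht : ∀ n, MeasurableSet (t n) := by simpa using ht
    have hT := fun τ n => (ht n).fominTranslate (h n) τ
    simp only [fominTranslate_pi, hpi s _ (hT τ), measureReal_infinitePi_pi (hT _)]
    simpa [smul_eq_mul] using HasDerivAt.fun_finsetProd (u := s)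
      (fun n _ => (hβ n).hasDerivAt (ht n) τ)
  · rintro _ ⟨s, t, ht, rfl⟩
    have ht : ∀ n, MeasurableSet (t n) := by simpa using ht
    have hT := fun τ n => (ht n).fominTranslate (h n) τ
    simp only [fominTranslate_pi, hpi s _ (hT _)]
    refine continuous_finsetSum _ fun n _ => .mul (continuous_finsetProd _ fun i _ => ?_)
      ((hβ n).continuous_setIntegral (ht n))
    exact continuous_iff_continuousAt.2 fun τ => ((hβ i).hasDerivAt (ht i) τ).continuousAt

/-- Centred functions of distinct coordinates are orthogonal in L², so the series converges there
once the squared norms are summable; the L¹ norm is dominated by the L² norm. -/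
theorem exists_integrable_tendsto_eLpNorm_sum {g : ℕ → ℝ → ℝ}
    (hm : ∀ n, Measurable (g n)) (h0 : ∀ n, ∫ x, g n x ∂μ n = 0) (h2 : ∀ n, MemLp (g n) 2 (μ n))
    (hsum : Summable fun n => ∫ x, g n x ^ 2 ∂μ n) :
    ∃ B : (ℕ → ℝ) → ℝ, Integrable B (Measure.infinitePi μ) ∧
      Tendsto (fun N : ℕ => eLpNorm
        (fun x : ℕ → ℝ => (∑ n ∈ Finset.range N, g n (x n)) - B x) 1 (Measure.infinitePi μ))
        atTop (𝓝 0) := by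
  set P := Measure.infinitePi μ
  have hL : ∀ n, MemLp (fun x : ℕ → ℝ => g n (x n)) 2 P := fun n =>
    (h2 n).comp_measurePreserving (measurePreserving_eval_infinitePi μ n)
  let v : ℕ → Lp ℝ 2 P := fun n => (hL n).toLp
  have hinner : ∀ m n, inner ℝ (v m) (v n) = ∫ x, g m (x m) * g n (x n) ∂P := by
    intro m n
    rw [L2.inner_def]
    refine integral_congr_ae ?_
    filter_upwards [(hL m).coeFn_toLp, (hL n).coeFn_toLp] with x hx hy
    simp only [v, hx, hy]
    simp [mul_comm]
  have horth : ∀ m n, m ≠ n → inner ℝ (v m) (v n) = 0 := by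
    intro m n hmn
    rw [hinner]
    have e := integral_infinitePi_prod (μ := μ) hm {m, n}
    simp only [Finset.prod_pair hmn, h0, mul_zero] at e
    exact e
  have hnorm : ∀ n, ‖v n‖ ^ 2 = ∫ x, g n x ^ 2 ∂μ n := by
    intro n
    rw [← real_inner_self_eq_norm_sq, hinner, ← (measurePreserving_eval_infinitePi μ n).map_eq,
      integral_map (measurable_pi_apply n).aemeasurable
      ((hm n).pow_const 2).aestronglyMeasurable]
    simp only [pow_two, P]
  have hV : OrthogonalFamily ℝ (fun n => Submodule.span ℝ {v n})
      fun n => (Submodule.span ℝ {v n}).subtypeₗᵢ := by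
    refine OrthogonalFamily.of_pairwise fun m n hmn => ?_
    refine Submodule.isOrtho_span.2 ?_
    rintro _ rfl _ rfl
    exact horth m n hmn
  have hsv : Summable v := by
    have := (hV.summable_iff_norm_sq_summable
      fun n => ⟨v n, Submodule.mem_span_singleton_self _⟩).2 (by simpa [hnorm] using hsum)
    simpa using this
  obtain ⟨b, hb⟩ := hsv
  have hb' := hb.tendsto_sum_nat
  have hbi : MemLp b 2 P := Lp.memLp b
  refine ⟨b, hbi.integrable (by norm_num), ?_⟩
  rw [Lp.tendsto_Lp_iff_tendsto_eLpNorm'] at hb'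
  refine tendsto_of_tendsto_of_tendsto_of_le_of_le tendsto_const_nhds hb' (fun _ => zero_le)
    fun N => ?_
  have hae : (fun x : ℕ → ℝ => (∑ n ∈ Finset.range N, g n (x n)) - b x) =ᵐ[P]
      ⇑(∑ n ∈ Finset.range N, v n) - b := by
    have h1 : ∀ᵐ x ∂P, ∀ n, v n x = g n (x n) := ae_all_iff.2 fun n => (hL n).coeFn_toLp
    filter_upwards [h1, Lp.coeFn_finsetSum (Finset.range N) v] with x hx hs
    rw [Pi.sub_apply, hs, Finset.sum_apply]
    simp only [hx]
  rw [eLpNorm_congr_ae hae]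
  exact eLpNorm_le_eLpNorm_of_exponent_le (by norm_num)
    ((Lp.aestronglyMeasurable _).sub hbi.1)

end InfinitePi

/-! ### The density proportional to exp(-|x|^p) and its score -/

section BesovBaseLaw

variable {p : ℝ}

theorem integrable_abs_rpow_mul_exp_neg {q : ℝ} (hp : 0 < p) (hq : -1 < q) :
    Integrable fun x : ℝ => |x| ^ q * Real.exp (-|x| ^ p) := by
  have hval := integral_comp_abs (f := fun y => y ^ q * Real.exp (-y ^ p))
  rw [integral_rpow_mul_exp_neg_rpow hp hq] at hval
  -- A non-integrable function has integral 0 by convention, which contradicts the positive Gamma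
  -- value.
  by_contra hn
  rw [integral_undef hn] at hval
  have := Real.Gamma_pos_of_pos (s := (q + 1) / p) (div_pos (by linarith) hp)
  have : 0 < 2 * (1 / p * Real.Gamma ((q + 1) / p)) := by positivity
  linarith

theorem integral_exp_neg_abs_rpow_pos (hp : 0 < p) : 0 < ∫ y : ℝ, Real.exp (-|y| ^ p) := by
  have hi := integrable_abs_rpow_mul_exp_neg (q := 0) hp (by norm_num)
  simp only [Real.rpow_zero, one_mul] at hi
  exact integral_exp_pos hi

theorem besovDensity_nonneg (p x : ℝ) : 0 ≤ besovDensity p x :=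
  mul_nonneg (inv_nonneg.2 (integral_nonneg fun _ => (Real.exp_pos _).le)) (Real.exp_pos _).le

theorem measurable_besovDensity (p : ℝ) : Measurable (besovDensity p) := by
  unfold besovDensity
  fun_prop

theorem setIntegral_besovBaseLaw {g : ℝ → ℝ} {A : Set ℝ} (hA : MeasurableSet A) :
    ∫ x in A, g x ∂besovBaseLaw p = ∫ x in A, besovDensity p x * g x := by
  rw [besovBaseLaw, restrict_withDensity hA, integral_withDensity_eq_integral_toReal_smul
    (measurable_besovDensity p).ennreal_ofReal (ae_of_all _ fun _ => ENNReal.ofReal_lt_top)]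
  simp [ENNReal.toReal_ofReal (besovDensity_nonneg p _)]

theorem integral_besovBaseLaw {g : ℝ → ℝ} :
    ∫ x, g x ∂besovBaseLaw p = ∫ x, besovDensity p x * g x := by
  simpa using setIntegral_besovBaseLaw (p := p) (g := g) .univ

theorem integrable_besovBaseLaw_iff {g : ℝ → ℝ} :
    Integrable g (besovBaseLaw p) ↔ Integrable fun x => besovDensity p x * g x := by
  rw [besovBaseLaw, integrable_withDensity_iff_integrable_smul'
    (measurable_besovDensity p).ennreal_ofReal (ae_of_all _ fun _ => ENNReal.ofReal_lt_top)]
  simp [ENNReal.toReal_ofReal (besovDensity_nonneg p _)]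

/-- The score `π_X' / π_X`. -/
noncomputable def besovScore (p x : ℝ) : ℝ := -p * Real.sign x * |x| ^ (p - 1)

theorem Real.measurable_sign : Measurable Real.sign := by
  unfold Real.sign
  exact Measurable.ite measurableSet_Iio measurable_const
    (Measurable.ite measurableSet_Ioi measurable_const measurable_const)

theorem measurable_besovScore (p : ℝ) : Measurable (besovScore p) := by
  unfold besovScore
  have := Real.measurable_sign
  fun_prop

theorem abs_besovScore_le (hp : 0 < p) (x : ℝ) : |besovScore p x| ≤ p * |x| ^ (p - 1) := by
  rw [besovScore, abs_mul, abs_mul, abs_neg, abs_of_pos hp,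
    abs_of_nonneg (Real.rpow_nonneg (abs_nonneg x) _)]
  have : |Real.sign x| ≤ 1 := by
    rcases Real.sign_apply_eq x with h | h | h <;> simp [h]
  have h2 := Real.rpow_nonneg (abs_nonneg x) (p - 1)
  calc p * |Real.sign x| * |x| ^ (p - 1) ≤ p * 1 * |x| ^ (p - 1) := by gcongr
    _ = _ := by ring

theorem hasDerivAt_besovDensity (hp : 1 < p) (x : ℝ) :
    HasDerivAt (besovDensity p) (besovDensity p x * besovScore p x) x := by
  have h := ((hasDerivAt_abs_rpow x hp).neg.exp).const_mul (∫ y : ℝ, Real.exp (-|y| ^ p))⁻¹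
  refine h.congr_deriv ?_
  have e : besovScore p x = -(p * |x| ^ (p - 2) * x) := by
    rw [besovScore]
    rcases lt_trichotomy x 0 with hx | rfl | hx
    · have : |x| ^ (p - 1) = |x| ^ (p - 2) * |x| := by
        rw [← Real.rpow_add_one (abs_pos.2 hx.ne).ne']
        ring_nf
      rw [this, Real.sign_of_neg hx, abs_of_neg hx]
      ring
    · simp
    · have : |x| ^ (p - 1) = |x| ^ (p - 2) * |x| := by
        rw [← Real.rpow_add_one (abs_pos.2 hx.ne').ne']
        ring_nf
      rw [this, Real.sign_of_pos hx, abs_of_pos hx]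
      ring
  rw [e, besovDensity]
  simp only [Pi.neg_apply]
  ring

theorem memLp_besovScore (hp : 1 < p) : MemLp (besovScore p) 2 (besovBaseLaw p) := by
  rw [memLp_two_iff_integrable_sq (measurable_besovScore p).aestronglyMeasurable,
    integrable_besovBaseLaw_iff]
  have h := (integrable_abs_rpow_mul_exp_neg (p := p) (q := 2 * (p - 1)) (by linarith)
    (by linarith)).const_mul ((∫ y : ℝ, Real.exp (-|y| ^ p))⁻¹ * p ^ 2)
  refine h.mono' ((measurable_besovDensity p).mul
    ((measurable_besovScore p).pow_const 2)).aestronglyMeasurable (ae_of_all _ fun x => ?_)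
  rw [norm_mul, norm_pow, Real.norm_eq_abs, Real.norm_eq_abs,
    abs_of_nonneg (besovDensity_nonneg p x)]
  have h1 : |x| ^ (2 * (p - 1)) = (|x| ^ (p - 1)) ^ 2 := by
    rw [mul_comm, Real.rpow_mul (abs_nonneg x)]
    norm_num
  calc besovDensity p x * |besovScore p x| ^ 2
      ≤ besovDensity p x * (p * |x| ^ (p - 1)) ^ 2 := by
        gcongr
        · exact besovDensity_nonneg p x
        · exact abs_besovScore_le (by linarith) x
    _ = _ := by rw [h1, besovDensity]; ring

theorem integrable_besovDensity (hp : 0 < p) : Integrable (besovDensity p) := by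
  have := isProbabilityMeasure_besovBaseLaw hp
  simpa using integrable_besovBaseLaw_iff.1 (integrable_const (μ := besovBaseLaw p) (1 : ℝ))

/-- Half-lines suffice as a π-system: translation moves the endpoint to b + ta, and the derivative
aπ(b + ta) of the distribution function equals the integral of aπ' up to that endpoint. -/
theorem isLogDerivative_besovBaseLaw (hp : 1 < p) (a : ℝ) :
    IsLogDerivative (besovBaseLaw p) a fun x => a * besovScore p x := by
  have hp0 : 0 < p := by linarith
  have := isProbabilityMeasure_besovBaseLaw hp0
  have hξ : Integrable (besovScore p) (besovBaseLaw p) :=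
    (memLp_besovScore hp).integrable (by norm_num)
  have hξ' := integrable_besovBaseLaw_iff.1 hξ
  have hcont : Continuous (besovDensity p) :=
    continuous_iff_continuousAt.2 fun x => (hasDerivAt_besovDensity hp x).continuousAt
  have hT : ∀ t b, fominTranslate a t (Set.Iic b) = Set.Iic (b + t * a) := by
    intro t b
    ext x
    simp [mem_fominTranslate]
  have hI : ∀ y, ∫ x in Set.Iic y, a * besovScore p x ∂besovBaseLaw p = a * besovDensity p y := by
    intro y
    rw [integral_const_mul, setIntegral_besovBaseLaw measurableSet_Iic,
      integral_Iic_of_hasDerivAt_of_tendsto' (fun x _ => hasDerivAt_besovDensity hp x)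
        hξ'.integrableOn (tendsto_zero_of_hasDerivAt_of_integrableOn_Iic (a := y)
        (fun x _ => hasDerivAt_besovDensity hp x) hξ'.integrableOn
        (integrable_besovDensity hp0).integrableOn), sub_zero]
  have hF : ∀ y, HasDerivAt (fun y => (besovBaseLaw p).real (Set.Iic y)) (besovDensity p y) y := by
    intro y
    have e : (fun y => (besovBaseLaw p).real (Set.Iic y)) = fun y =>
        (∫ x in Set.Iic (0 : ℝ), besovDensity p x) + ∫ x in (0 : ℝ)..y, besovDensity p x := by
      ext y
      have h1 := setIntegral_besovBaseLaw (p := p) (g := fun _ => 1) (measurableSet_Iic (a := y))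
      simp only [integral_const, MeasurableSet.univ, measureReal_restrict_apply, Set.univ_inter,
        smul_eq_mul, mul_one] at h1
      rw [h1, ← intervalIntegral.integral_Iic_sub_Iic
        (integrable_besovDensity hp0).integrableOn (integrable_besovDensity hp0).integrableOn]
      ring
    rw [e]
    exact (hcont.integral_hasStrictDerivAt 0 y).hasDerivAt.const_add _
  refine isLogDerivative_of_isPiSystem
    (BorelSpace.measurable_eq.trans (borel_eq_generateFrom_Iic ℝ)) isPiSystem_Iic
    (hξ.const_mul a) ?_ ?_ ?_
  · rw [integral_const_mul, integral_besovBaseLaw,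
      integral_eq_zero_of_hasDerivAt_of_integrable (hasDerivAt_besovDensity hp) hξ'
      (integrable_besovDensity hp0), mul_zero]
  · rintro _ ⟨b, rfl⟩ t
    simp only [hT, hI]
    have h1 : HasDerivAt (fun t : ℝ => b + t * a) a t := by
      simpa using ((hasDerivAt_id t).mul_const a).const_add b
    exact ((hF (b + t * a)).comp t h1).congr_deriv (mul_comm _ _)
  · rintro _ ⟨b, rfl⟩
    simp only [hT, hI]
    fun_prop

end BesovBaseLaw

/-! ### Rescaling to the coordinate laws -/

section BesovCoordLaw

theorem IsLogDerivative.map_mul_left {μ : Measure ℝ} {a c : ℝ} {β : ℝ → ℝ} (hβ : Measurable β)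
    (H : IsLogDerivative μ a fun x => β (c * x)) :
    IsLogDerivative (μ.map fun x => c * x) (c * a) β := by
  have hc : Measurable fun x : ℝ => c * x := by fun_prop
  refine ⟨(integrable_map_measure hβ.aestronglyMeasurable hc.aemeasurable).2 H.1, fun A hA => ?_⟩
  have h1 := hasFominDerivAt_iff.1 (H.2 _ (hc hA))
  rw [hasFominDerivAt_iff, setIntegral_map hA hβ.aestronglyMeasurable hc.aemeasurable]
  have e : (fun t => (μ.map fun x => c * x).real (fominTranslate (c * a) t A)) =
      fun t => μ.real (fominTranslate a t ((fun x => c * x) ⁻¹' A)) := by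
    ext t
    rw [map_measureReal_apply hc (hA.fominTranslate _ _)]
    congr 1
    ext x
    simp only [Set.mem_preimage, mem_fominTranslate, smul_eq_mul]
    ring_nf
  rwa [e]

variable (d : ℕ) (s : ℝ) {p : ℝ}

/-- The standard deviation parameter `ℓ ^ (-s / d - 1 / 2 + 1 / p)` of `ρ_ℓ`, `ℓ = n + 1`. -/
noncomputable def besovScale (d : ℕ) (s p : ℝ) (n : ℕ) : ℝ :=
  ((n : ℝ) + 1) ^ (-s / d - 1 / 2 + 1 / p)

theorem besovScale_pos (p : ℝ) (n : ℕ) : 0 < besovScale d s p n :=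
  Real.rpow_pos_of_pos (by positivity) _

theorem besovCoordLaw_eq_map (p : ℝ) (n : ℕ) :
    besovCoordLaw d s p n = (besovBaseLaw p).map fun x => besovScale d s p n * x := rfl

theorem Real.sign_mul_of_pos {c : ℝ} (hc : 0 < c) (x : ℝ) : Real.sign (c * x) = Real.sign x := by
  rcases lt_trichotomy x 0 with hx | rfl | hx
  · rw [Real.sign_of_neg hx, Real.sign_of_neg (mul_neg_of_pos_of_neg hc hx)]
  · simp
  · rw [Real.sign_of_pos hx, Real.sign_of_pos (mul_pos hc hx)]

theorem besovCoordLogDeriv_mul (hp : 1 < p) (n : ℕ) (a x : ℝ) :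
    besovCoordLogDeriv d s p n a (besovScale d s p n * x) =
      a / besovScale d s p n * besovScore p x := by
  have hc := besovScale_pos d s p n
  have hl : (0 : ℝ) < (n : ℝ) + 1 := by positivity
  rw [besovCoordLogDeriv, besovScore, Real.sign_mul_of_pos hc, abs_mul, abs_of_pos hc,
    Real.mul_rpow hc.le (abs_nonneg x)]
  -- The exponents add up to s/d + 1/2 - 1/p, the negative of that of the scale.
  have e : ((n : ℝ) + 1) ^ (p * (s / d + 1 / 2) - 1) * besovScale d s p n ^ (p - 1)
      = (besovScale d s p n)⁻¹ := by
    rw [besovScale, ← Real.rpow_mul hl.le, ← Real.rpow_neg hl.le, ← Real.rpow_add hl]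
    congr 1
    have : p ≠ 0 := by linarith
    field_simp
    ring
  rw [div_eq_mul_inv a, ← e]
  ring

theorem measurable_besovCoordLogDeriv (p : ℝ) (n : ℕ) (a : ℝ) :
    Measurable (besovCoordLogDeriv d s p n a) := by
  unfold besovCoordLogDeriv
  have := Real.measurable_sign
  fun_prop

theorem isLogDerivative_besovCoordLaw (hp : 1 < p) (n : ℕ) (a : ℝ) :
    IsLogDerivative (besovCoordLaw d s p n) a (besovCoordLogDeriv d s p n a) := by
  have hc := besovScale_pos d s p n
  have h := isLogDerivative_besovBaseLaw hp (a / besovScale d s p n)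
  simp only [← besovCoordLogDeriv_mul d s hp n a] at h
  have := h.map_mul_left (measurable_besovCoordLogDeriv d s p n a)
  rwa [mul_div_cancel₀ _ hc.ne'] at this

theorem memLp_besovCoordLogDeriv (hp : 1 < p) (n : ℕ) (a : ℝ) :
    MemLp (besovCoordLogDeriv d s p n a) 2 (besovCoordLaw d s p n) := by
  rw [besovCoordLaw_eq_map, memLp_map_measure_iff
    (measurable_besovCoordLogDeriv d s p n a).aestronglyMeasurable (by fun_prop)]
  simp only [Function.comp_def, besovCoordLogDeriv_mul d s hp]
  exact (memLp_besovScore hp).const_mul _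

theorem integral_besovCoordLogDeriv_sq (hp : 1 < p) (n : ℕ) (a : ℝ) :
    ∫ x, besovCoordLogDeriv d s p n a x ^ 2 ∂besovCoordLaw d s p n =
      (a / besovScale d s p n) ^ 2 * ∫ x, besovScore p x ^ 2 ∂besovBaseLaw p := by
  rw [besovCoordLaw_eq_map, integral_map (by fun_prop)
    ((measurable_besovCoordLogDeriv d s p n a).pow_const 2).aestronglyMeasurable]
  simp only [besovCoordLogDeriv_mul d s hp, mul_pow, integral_const_mul]

theorem mem_besovSpace_iff {d : ℕ} (hd : 0 < d) {s : ℝ} {h : ℕ → ℝ} :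
    h ∈ besovSpace d (s + (1 / 2 - 1 / p) * d) 2 ↔
      Summable fun n => (h n / besovScale d s p n) ^ 2 := by
  rw [besovSpace, Set.mem_ofPred_eq]
  refine summable_congr fun n => ?_
  have hl : (0 : ℝ) < (n : ℝ) + 1 := by positivity
  rw [div_pow, besovScale, ← Real.rpow_natCast (((n : ℝ) + 1) ^ _), ← Real.rpow_mul hl.le,
    div_eq_mul_inv (h n ^ 2), ← Real.rpow_neg hl.le, mul_comm, Real.rpow_two, sq_abs]
  congr 2
  have : (d : ℝ) ≠ 0 := by positivity
  rw [add_div, mul_div_cancel_right₀ _ this]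
  push_cast
  ring

end BesovCoordLaw

/-! ### Necessity: separating the prior from its translates by signs -/

section SignStatistic

theorem Real.sign_mono {x y : ℝ} (h : x ≤ y) : Real.sign x ≤ Real.sign y := by
  rcases lt_trichotomy x 0 with hx | rfl | hx
  · rw [Real.sign_of_neg hx]
    rcases Real.sign_apply_eq y with h | h | h <;> norm_num [h]
  · rcases h.eq_or_lt with rfl | hy
    · rfl
    · simp [Real.sign_of_pos hy]
  · rw [Real.sign_of_pos hx, Real.sign_of_pos (hx.trans_le h)]

theorem Real.abs_sign_le_one (x : ℝ) : |Real.sign x| ≤ 1 := by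
  rcases Real.sign_apply_eq x with h | h | h <;> simp [h]

theorem integrable_sign_sub (μ : Measure ℝ) [IsFiniteMeasure μ] (s : ℝ) :
    Integrable (fun x => Real.sign (x - s)) μ :=
  .of_bound (Real.measurable_sign.comp (measurable_id.sub_const s)).aestronglyMeasurable 1
    (ae_of_all _ fun _ => Real.abs_sign_le_one _)

variable {p : ℝ}

theorem besovDensity_neg (p x : ℝ) : besovDensity p (-x) = besovDensity p x := by
  simp [besovDensity]

theorem besovDensity_pos (hp : 0 < p) (x : ℝ) : 0 < besovDensity p x :=
  mul_pos (inv_pos.2 (integral_exp_neg_abs_rpow_pos hp)) (Real.exp_pos _)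

theorem integral_sign_add_besovBaseLaw (p s : ℝ) :
    ∫ x, Real.sign (x + s) ∂besovBaseLaw p = -∫ x, Real.sign (x - s) ∂besovBaseLaw p := by
  rw [integral_besovBaseLaw, integral_besovBaseLaw, ← integral_neg_eq_self, ← integral_neg]
  refine integral_congr_ae (ae_of_all _ fun x => ?_)
  simp only [besovDensity_neg]
  rw [show -x + s = -(x - s) by ring, Real.sign_neg, mul_neg]

/-- The density decreases in |x|, so on (0, 1) it is at least its value at 1. -/
theorem besovDensity_one_mul_le (hp : 0 < p) {r : ℝ} (h0 : 0 ≤ r) (h1 : r ≤ 1) :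
    besovDensity p 1 * r ≤ (besovBaseLaw p).real (Set.Ioo 0 r) := by
  have h := setIntegral_besovBaseLaw (p := p) (g := fun _ => 1) (measurableSet_Ioo (a := 0) (b := r))
  simp only [integral_const, MeasurableSet.univ, measureReal_restrict_apply, Set.univ_inter,
    smul_eq_mul, mul_one] at h
  rw [h]
  calc besovDensity p 1 * r = ∫ x in Set.Ioo 0 r, besovDensity p 1 := by
        simp [Real.volume_real_Ioo_of_le h0, mul_comm]
    _ ≤ _ := by
        refine setIntegral_mono_on (by simp) (integrable_besovDensity hp).integrableOn
          measurableSet_Ioo fun x hx => ?_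
        have : 0 ≤ (∫ y : ℝ, Real.exp (-|y| ^ p))⁻¹ :=
          (inv_pos.2 (integral_exp_neg_abs_rpow_pos hp)).le
        unfold besovDensity
        gcongr
        · exact hx.1.le
        · exact hx.2.le.trans h1

/-- By symmetry the sign has mean zero. Shifting by s lowers it on (0, s), and the cap at 1 keeps
the density there bounded below. -/
theorem integral_sign_sub_le (hp : 0 < p) {s : ℝ} (hs : 0 ≤ s) :
    ∫ x, Real.sign (x - s) ∂besovBaseLaw p ≤ -(besovDensity p 1 * min 1 s) := by
  have := isProbabilityMeasure_besovBaseLaw hp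
  have h0 : ∫ x, Real.sign x ∂besovBaseLaw p = 0 := by
    have := integral_sign_add_besovBaseLaw p 0
    simp only [add_zero, sub_zero] at this
    linarith
  have hi0 : Integrable Real.sign (besovBaseLaw p) := by
    simpa using integrable_sign_sub (besovBaseLaw p) 0
  have hi1 : Integrable ((Set.Ioo 0 (min 1 s)).indicator (1 : ℝ → ℝ)) (besovBaseLaw p) :=
    (integrable_const (1 : ℝ)).indicator measurableSet_Ioo
  have hle : ∫ x, Real.sign (x - s) ∂besovBaseLaw p ≤
      ∫ x, (Real.sign x - (Set.Ioo 0 (min 1 s)).indicator 1 x) ∂besovBaseLaw p := by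
    refine integral_mono (integrable_sign_sub _ s)
      (hi0.sub hi1) fun x => ?_
    by_cases hx : x ∈ Set.Ioo 0 (min 1 s)
    · have h1 : x < s := hx.2.trans_le (min_le_right _ _)
      simp only [Set.indicator_of_mem hx, Pi.one_apply]
      rw [Real.sign_of_pos hx.1, Real.sign_of_neg (by linarith)]
      norm_num
    · simp only [Set.indicator_of_notMem hx, sub_zero]
      exact Real.sign_mono (by linarith)
  have h2 := besovDensity_one_mul_le hp (le_min zero_le_one hs) (min_le_left 1 s)
  rw [integral_sub hi0 hi1, h0,
    integral_indicator_one measurableSet_Ioo] at hle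
  linarith

/-- Truncation of a real number to `[-1, 1]`. -/
noncomputable def unitClamp (x : ℝ) : ℝ := max (-1) (min 1 x)

theorem unitClamp_of_nonneg {x : ℝ} (hx : 0 ≤ x) : unitClamp x = min 1 x :=
  max_eq_right (by have := le_min zero_le_one hx; linarith)

theorem unitClamp_neg (x : ℝ) : unitClamp (-x) = -unitClamp x := by
  unfold unitClamp
  rcases le_total 1 x with h | h <;> rcases le_total (-1) x with h' | h' <;>
    simp only [max_def, min_def] <;> split_ifs <;> linarith

theorem unitClamp_mul_integral_sign_sub_le (hp : 0 < p) (s : ℝ) :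
    unitClamp s * ∫ x, Real.sign (x - s) ∂besovBaseLaw p ≤
      -(besovDensity p 1 * unitClamp s ^ 2) := by
  have key : ∀ s, 0 ≤ s → unitClamp s * ∫ x, Real.sign (x - s) ∂besovBaseLaw p ≤
      -(besovDensity p 1 * unitClamp s ^ 2) := by
    intro s hs
    rw [unitClamp_of_nonneg hs]
    have := mul_le_mul_of_nonneg_left (integral_sign_sub_le hp hs) (le_min zero_le_one hs)
    linarith
  rcases le_total 0 s with hs | hs
  · exact key s hs
  · have := key (-s) (by linarith)
    rw [unitClamp_neg] at this
    simp only [sub_neg_eq_add, integral_sign_add_besovBaseLaw] at this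
    linarith

/-- The clamped terms tend to zero, so all but finitely many are below 1 in modulus, where clamping
changes nothing. -/
theorem summable_sq_of_summable_unitClamp_sq {k : ℕ → ℝ}
    (h : Summable fun n => unitClamp (k n) ^ 2) : Summable fun n => k n ^ 2 := by
  have h1 := h.tendsto_atTop_zero.eventually (gt_mem_nhds zero_lt_one)
  have he : (fun n => unitClamp (k n) ^ 2) =ᶠ[cofinite] fun n => k n ^ 2 := by
    rw [Nat.cofinite_eq_atTop]
    filter_upwards [h1] with n hn
    have h2 := abs_lt.1 ((sq_lt_one_iff_abs_lt_one _).1 hn)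
    have : unitClamp (k n) = k n := by
      unfold unitClamp at *
      rcases le_total 1 (k n) with h | h
      · rw [min_eq_left h] at h2
        norm_num at h2
      · rw [min_eq_right h] at h2 ⊢
        rcases le_total (-1) (k n) with h' | h'
        · exact max_eq_right h'
        · rw [max_eq_left h'] at h2
          norm_num at h2
    rw [this]
  exact (summable_congr_cofinite he).1 h

/-- Chebyshev's inequality for a sum of bounded functions of the coordinates. -/
theorem measureReal_infinitePi_abs_sum_sub_ge_le {μ : ℕ → Measure ℝ}
    [∀ n, IsProbabilityMeasure (μ n)] {g : ℕ → ℝ → ℝ} (hg : ∀ n, Measurable (g n)) {w : ℕ → ℝ}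
    (hw : ∀ n x, |g n x| ≤ |w n|) (N : ℕ) {r : ℝ} (hr : 0 < r) :
    (Measure.infinitePi μ).real {u | r ≤ |∑ n ∈ Finset.range N, g n (u n) -
      ∑ n ∈ Finset.range N, ∫ x, g n x ∂μ n|} ≤ (∑ n ∈ Finset.range N, w n ^ 2) / r ^ 2 := by
  set P := Measure.infinitePi μ
  have hb : ∀ n, MemLp (fun u : ℕ → ℝ => g n (u n)) 2 P := fun n =>
    .of_bound ((hg n).comp (measurable_pi_apply n)).aestronglyMeasurable |w n|
      (ae_of_all _ fun u => hw n (u n))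
  have hind := ProbabilityTheory.iIndepFun_infinitePi (P := μ) hg
  have hvar : ProbabilityTheory.variance (∑ n ∈ Finset.range N, fun u : ℕ → ℝ => g n (u n)) P ≤
      ∑ n ∈ Finset.range N, w n ^ 2 := by
    rw [ProbabilityTheory.IndepFun.variance_sum (fun n _ => hb n)
      fun i _ j _ hij => hind.indepFun hij]
    refine Finset.sum_le_sum fun n _ => ?_
    refine (ProbabilityTheory.variance_le_expectation_sq (hb n).1).trans ?_
    have := integral_mono (μ := P) (f := fun u => (g n (u n)) ^ 2) (g := fun _ => w n ^ 2)
      (hb n).integrable_sq (integrable_const _) fun u => sq_le_sq.2 (hw n (u n))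
    simpa using this
  have hmean : ∫ u, (∑ n ∈ Finset.range N, fun u : ℕ → ℝ => g n (u n)) u ∂P =
      ∑ n ∈ Finset.range N, ∫ x, g n x ∂μ n := by
    simp only [Finset.sum_apply]
    rw [integral_finsetSum _ fun n _ => (hb n).integrable (by norm_num)]
    refine Finset.sum_congr rfl fun n _ => ?_
    rw [← (measurePreserving_eval_infinitePi μ n).map_eq,
      integral_map (measurable_pi_apply n).aemeasurable (hg n).aestronglyMeasurable]
  have h := ProbabilityTheory.meas_ge_le_variance_div_sq (memLp_finsetSum' (Finset.range N)
    fun n _ => hb n) hr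
  rw [hmean] at h
  simp only [Finset.sum_apply] at h
  refine (ENNReal.toReal_le_of_le_ofReal (by positivity) (h.trans
    (ENNReal.ofReal_le_ofReal ?_)))
  gcongr

variable {d : ℕ} {s : ℝ}

theorem integral_sign_sub_besovCoordLaw (d : ℕ) (s p : ℝ) (n : ℕ) (a : ℝ) :
    ∫ x, Real.sign (x - a) ∂besovCoordLaw d s p n =
      ∫ x, Real.sign (x - a / besovScale d s p n) ∂besovBaseLaw p := by
  have hc := besovScale_pos d s p n
  have hm : Measurable fun x => Real.sign (x - a) :=
    Real.measurable_sign.comp (measurable_id.sub_const a)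
  rw [besovCoordLaw_eq_map, integral_map (by fun_prop) hm.aestronglyMeasurable]
  refine integral_congr_ae (ae_of_all _ fun x => ?_)
  simp only
  rw [← Real.sign_mul_of_pos hc (x - _), mul_sub, mul_div_cancel₀ _ hc.ne']

/-- The statistic ∑ w_n sign(u_n), with w_n the clamped relative shift, has mean 0; evaluated at u -
th its mean is at most -cV, where V = ∑ w_n². Both variances are at most V, so for large V the
threshold -cV/2 separates the two by Chebyshev. -/
theorem exists_measurableSet_besovPrior_separating (hp : 0 < p) {h : ℕ → ℝ}
    (hh : ¬ Summable fun n => (h n / besovScale d s p n) ^ 2) {t : ℝ} (ht : t ≠ 0) {ε : ℝ}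
    (hε : 0 < ε) :
    ∃ A, MeasurableSet A ∧ (besovPrior d s p).real Aᶜ ≤ ε ∧
      (besovPrior d s p).real (fominTranslate h t A) ≤ ε := by
  have := isProbabilityMeasure_besovCoordLaw d s hp
  have hprob : IsProbabilityMeasure (besovPrior d s p) := by unfold besovPrior; infer_instance
  set w : ℕ → ℝ := fun n => unitClamp (t * h n / besovScale d s p n)
  set c := besovDensity p 1
  have hc : 0 < c := besovDensity_pos hp 1
  have hns : ¬ Summable fun n => w n ^ 2 := by
    intro H
    apply hh
    have := summable_sq_of_summable_unitClamp_sq H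
    simp only [mul_div_assoc, mul_pow] at this
    exact (summable_mul_left_iff (pow_ne_zero 2 ht)).1 this
  have htop := (not_summable_iff_tendsto_nat_atTop_of_nonneg fun n => sq_nonneg (w n)).1 hns
  -- Chebyshev at deviation cV/2 costs V / (cV/2)² = 4 / (c²V), which is at most ε for this V.
  obtain ⟨N, hN⟩ := (htop.eventually (eventually_ge_atTop (4 / (c ^ 2 * ε)))).exists
  set V := ∑ n ∈ Finset.range N, w n ^ 2
  have hV : 0 < V := lt_of_lt_of_le (by positivity) hN
  have hVε : V / (c * V / 2) ^ 2 ≤ ε := by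
    rw [div_le_iff₀ (by positivity)] at hN
    rw [div_le_iff₀ (by positivity)]
    nlinarith
  have hgm : ∀ (a : ℕ → ℝ) (n : ℕ), Measurable fun x => w n * Real.sign (x - a n) := fun a n =>
    (Real.measurable_sign.comp (measurable_id.sub_const (a n))).const_mul _
  have cheb := fun a : ℕ → ℝ => (measureReal_infinitePi_abs_sum_sub_ge_le
    (μ := besovCoordLaw d s p) (hgm a) (w := w) (fun n x => by
      rw [abs_mul]
      exact mul_le_of_le_one_right (abs_nonneg _) (Real.abs_sign_le_one _)) N
      (show 0 < c * V / 2 by positivity)).trans hVε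
  have hmean : ∀ a : ℕ → ℝ, ∑ n ∈ Finset.range N,
      ∫ x, w n * Real.sign (x - a n) ∂besovCoordLaw d s p n = ∑ n ∈ Finset.range N,
      w n * ∫ x, Real.sign (x - a n / besovScale d s p n) ∂besovBaseLaw p := fun a =>
    Finset.sum_congr rfl fun n _ => by
      rw [integral_const_mul, integral_sign_sub_besovCoordLaw]
  have hmean0 : ∑ n ∈ Finset.range N,
      ∫ x, w n * Real.sign (x - 0) ∂besovCoordLaw d s p n = 0 := by
    rw [hmean fun _ => 0]
    have h0 := integral_sign_add_besovBaseLaw p 0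
    simp only [add_zero, sub_zero] at h0
    have : ∫ x, Real.sign x ∂besovBaseLaw p = 0 := by linarith
    simp [this]
  have hmeant : ∑ n ∈ Finset.range N,
      ∫ x, w n * Real.sign (x - t * h n) ∂besovCoordLaw d s p n ≤ -(c * V) := by
    rw [hmean fun n => t * h n, Finset.mul_sum, ← Finset.sum_neg_distrib]
    exact Finset.sum_le_sum fun n _ => unitClamp_mul_integral_sign_sub_le hp _
  refine ⟨{u | -(c * V / 2) < ∑ n ∈ Finset.range N, w n * Real.sign (u n - 0)}, ?_, ?_, ?_⟩
  · exact measurableSet_lt measurable_const (Finset.measurable_fun_sum _ fun n _ =>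
      (hgm (fun _ => 0) n).comp (measurable_pi_apply n))
  · refine (measureReal_mono fun u hu => ?_).trans (cheb fun _ => 0)
    simp only [Set.mem_compl_iff, Set.mem_ofPred_eq, not_lt] at hu ⊢
    rw [hmean0, sub_zero]
    exact le_trans (by linarith) (neg_le_abs _)
  · refine (measureReal_mono fun u hu => ?_).trans (cheb fun n => t * h n)
    simp only [mem_fominTranslate, Set.mem_ofPred_eq, sub_zero, Pi.sub_apply, Pi.smul_apply,
      smul_eq_mul] at hu ⊢
    exact le_trans (by linarith) (le_abs_self _)

/-- A Fomin derivative at a set A forces t ↦ P(A + th) to be continuous at 0. The intersection of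
separating sets for t = 1/(k+1) violates this. -/
theorem summable_of_isFominDifferentiable_besovPrior (hp : 0 < p) {h : ℕ → ℝ}
    (H : IsFominDifferentiable (besovPrior d s p) h) :
    Summable fun n => (h n / besovScale d s p n) ^ 2 := by
  by_contra hh
  have := isProbabilityMeasure_besovCoordLaw d s hp
  have hprob : IsProbabilityMeasure (besovPrior d s p) := by unfold besovPrior; infer_instance
  set P := besovPrior d s p
  choose A hAm hA1 hA2 using fun k : ℕ => exists_measurableSet_besovPrior_separating hp hh
    (t := 1 / ((k : ℝ) + 1)) (by positivity) (ε := 1 / 8 * (1 / 2) ^ k) (by positivity)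
  obtain ⟨L, hL⟩ := H (⋂ k, A k) (.iInter hAm)
  have hcont := (hasFominDerivAt_iff.1 hL).continuousAt
  have hlim := hcont.tendsto.comp (tendsto_one_div_add_atTop_nhds_zero_nat (𝕜 := ℝ))
  rw [fominTranslate_zero] at hlim
  -- The complements have total mass at most 1/4, so the intersection has mass at least 3/4, whereas
  -- continuity along t = 1/(k+1) bounds it by 1/8.
  have hsum : HasSum (fun k : ℕ => (1 / 8 * (1 / 2) ^ k : ℝ)) (1 / 8 * 2) :=
    hasSum_geometric_two.mul_left _
  have hcompl : P.real (⋂ k, A k)ᶜ ≤ 1 / 8 * 2 := by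
    rw [Set.compl_iInter]
    have h1 : P (⋃ k, (A k)ᶜ) ≤ ENNReal.ofReal (1 / 8 * 2) := by
      refine (measure_iUnion_le _).trans ?_
      rw [← hsum.tsum_eq, ENNReal.ofReal_tsum_of_nonneg (fun k => by positivity) hsum.summable]
      refine ENNReal.tsum_le_tsum fun k => ?_
      rw [← ofReal_measureReal]
      exact ENNReal.ofReal_le_ofReal (hA1 k)
    exact ENNReal.toReal_le_of_le_ofReal (by norm_num) h1
  rw [measureReal_compl (.iInter hAm), probReal_univ] at hcompl
  have hle : P.real (⋂ k, A k) ≤ 1 / 8 := by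
    refine le_of_tendsto hlim (Eventually.of_forall fun k => ?_)
    refine (measureReal_mono (Set.preimage_mono (Set.iInter_subset A k))).trans
      ((hA2 k).trans ?_)
    have : ((1 : ℝ) / 2) ^ k ≤ 1 := pow_le_one₀ (by norm_num) (by norm_num)
    linarith
  linarith

end SignStatistic

/-! ### Uniqueness of the logarithmic derivative and the main theorem -/

theorem IsLogDerivative.ae_eq {X : Type*} [AddCommGroup X] [Module ℝ X] [MeasurableSpace X]
    {μ : Measure X} {h : X} {β β' : X → ℝ} (H : IsLogDerivative μ h β)
    (H' : IsLogDerivative μ h β') : β =ᵐ[μ] β' :=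
  H.1.ae_eq_of_forall_setIntegral_eq _ _ H'.1 fun A hA _ =>
    tendsto_nhds_unique (H.2 A hA) (H'.2 A hA)

theorem exists_isLogDerivative_besovPrior (d : ℕ) (s : ℝ) {p : ℝ} (hp : 1 < p) {h : ℕ → ℝ}
    (hh : Summable fun n => (h n / besovScale d s p n) ^ 2) :
    ∃ B : (ℕ → ℝ) → ℝ, IsLogDerivative (besovPrior d s p) h B ∧
      Tendsto (fun N : ℕ => eLpNorm (fun u : ℕ → ℝ =>
        (∑ n ∈ Finset.range N, besovCoordLogDeriv d s p n (h n) (u n)) - B u) 1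
        (besovPrior d s p)) atTop (𝓝 0) := by
  have := isProbabilityMeasure_besovCoordLaw d s (zero_lt_one.trans hp)
  have hβ := fun n => isLogDerivative_besovCoordLaw d s hp n (h n)
  have hm := fun n => measurable_besovCoordLogDeriv d s p n (h n)
  obtain ⟨B, hB, hlim⟩ := exists_integrable_tendsto_eLpNorm_sum hm
    (fun n => (hβ n).integral_eq_zero) (fun n => memLp_besovCoordLogDeriv d s hp n (h n))
    (by simpa only [integral_besovCoordLogDeriv_sq d s hp] using hh.mul_right _)
  exact ⟨B, isLogDerivative_infinitePi_of_tendsto hβ hm hB hlim, hlim⟩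

theorem mainTheorem8 (d : ℕ) (hd : 0 < d) (s p : ℝ) (hp : 1 < p) :
    fominDomain (besovPrior d s p) = besovSpace d (s + (1 / 2 - 1 / p) * d) 2 ∧
    (∀ (n : ℕ) (a : ℝ),
      IsLogDerivative (besovCoordLaw d s p n) a (besovCoordLogDeriv d s p n a)) ∧
    ∀ h ∈ fominDomain (besovPrior d s p),
      (∃ β : (ℕ → ℝ) → ℝ, IsLogDerivative (besovPrior d s p) h β) ∧
      ∀ β : (ℕ → ℝ) → ℝ, IsLogDerivative (besovPrior d s p) h β →
        Tendsto
          (fun N : ℕ => eLpNorm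
            (fun u : ℕ → ℝ =>
              (∑ n ∈ Finset.range N, besovCoordLogDeriv d s p n (h n) (u n)) - β u)
            1 (besovPrior d s p))
          atTop (𝓝 0) := by
  have hsum : ∀ h ∈ fominDomain (besovPrior d s p),
      Summable fun n => (h n / besovScale d s p n) ^ 2 := fun h hh =>
    summable_of_isFominDifferentiable_besovPrior (zero_lt_one.trans hp) hh
  refine ⟨Set.Subset.antisymm (fun h hh => (mem_besovSpace_iff hd).2 (hsum h hh)) ?_,
    isLogDerivative_besovCoordLaw d s hp, fun h hh => ?_⟩
  · intro h hh A hA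
    obtain ⟨B, hB, -⟩ := exists_isLogDerivative_besovPrior d s hp ((mem_besovSpace_iff hd).1 hh)
    exact ⟨_, hB.2 A hA⟩
  · obtain ⟨B, hB, hlim⟩ := exists_isLogDerivative_besovPrior d s hp (hsum h hh)
    refine ⟨⟨B, hB⟩, fun β hβ => hlim.congr fun N => eLpNorm_congr_ae ?_⟩
    filter_upwards [hB.ae_eq hβ] with u hu
    rw [hu]
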